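/- Let $g:(0,\infty)\to\mathbb R$ be the impulse response of a causal, stable, linear time-invariant continuous-time system, i.e. $\int_0^\infty |g(\tau)|\,d\tau<\infty$, let $h>0$ be the sampling period and put $\operatorname{sinc}(t)=\sin(\pi t)/(\pi t)$, $\operatorname{sinc}(0)=1$. The band-limited equivalent impulse response of the system is $$g_{\rm BL}(kh)=\frac1h\int_0^\infty g(\tau)\,\operatorname{sinc}\Big(\frac{kh-\tau}{h}\Big)\,d\tau,\qquad k\in\mathbb Z .$$ Let $e(h),e(2h),\dots$ be discrete white noise of finite variance, i.e. independent, identically distributed real random variables with mean zero and variance $\lambda^2\in(0,\infty)$. Let $v(h),v(2h),\dots$ be a zero-mean real stochastic process with constant finite variance $\sigma^2$, independent of the process $e$. For every $N\ge 1$ consider the experiment with input $$u_N(t)=\sum_{n=1}^N e(nh)\,\operatorname{sinc}\Big(\frac{t-nh}{h}\Big),$$ output $x_N(t)=\int_0^\infty g(\tau)u_N(t-\tau)\,d\tau$ and noisy measurements $y_N(kh)=x_N(kh)+v(kh)$, $k=1,\dots,N$. Let $M_{nc},M_c$ be any integers with $M_{nc}+M_c\ge 0$, let $\Phi_N$ be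 the $N\times(M_{nc}+M_c+1)$ matrix with entries $h\,u_N((k-n)h)$ (row $k=1,\dots,N$, column $n=-M_{nc},\dots,M_c$), let $\mathbf y_N=(y_N(h),\dots,y_N(Nh))^\top$, and let $$\hat\rho_N=(\Phi_N^\top\Phi_N)^{-1}\Phi_N^\top\mathbf y_N,\qquad \rho^*=\big(g_{\rm BL}(-M_{nc}h),\,g_{\rm BL}((1-M_{nc})h),\dots,g_{\rm BL}(M_ch)\big)^\top .$$ Then, almost surely, $\Phi_N^\top\Phi_N$ is invertible for all sufficiently large $N$ and $\hat\rho_N\to\rho^*$ as $N\to\infty$. -/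

import Mathlib

open MeasureTheory ProbabilityTheory Filter Topology
open scoped Matrix

noncomputable section

namespace BandLimited

/-- The normalized sinc function `sin (π t) / (π t)`, with value `1` at `t = 0`. -/
def nsinc (t : ℝ) : ℝ := Real.sinc (Real.pi * t)

/-- Stability of the causal convolution system with impulse response `g` (only the values of `g`
on `(0, ∞)` matter): the impulse response is absolutely integrable. -/
def StableImpulseResponse (g : ℝ → ℝ) : Prop := IntegrableOn g (Set.Ioi 0)

/-- Output of the causal linear time-invariant system with impulse response `g`:
`x(t) = ∫_0^∞ g(τ) u(t - τ) dτ`. -/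
def systemOutput (g u : ℝ → ℝ) (t : ℝ) : ℝ := ∫ τ in Set.Ioi (0 : ℝ), g τ * u (t - τ)

/-- Band-limited equivalent impulse response at time `k h`:
`g_BL(kh) = (1/h) ∫_0^∞ g(τ) sinc((kh - τ)/h) dτ`. -/
def gBL (h : ℝ) (g : ℝ → ℝ) (k : ℤ) : ℝ :=
  1 / h * ∫ τ in Set.Ioi (0 : ℝ), g τ * nsinc ((k * h - τ) / h)

/-- Sinc interpolation of `N` samples. Here `e n` is the sample at time `(n + 1) h`, so that the
samples are located at `h, 2h, …, N h`. -/
def sincInput (h : ℝ) (N : ℕ) (e : ℕ → ℝ) (t : ℝ) : ℝ :=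
  ∑ n ∈ Finset.range N, e n * nsinc ((t - ((n : ℝ) + 1) * h) / h)

/-- Noisy sampled output `(y(h), …, y(Nh))`, `y(kh) = x(kh) + v(kh)`, of the system with impulse
response `g` and input `u`. Index `k : Fin N` stands for time `(k + 1) h`, and `v k` is the noise
at that time. -/
def measuredOutput (h : ℝ) (g u : ℝ → ℝ) (v : ℕ → ℝ) (N : ℕ) : Fin N → ℝ :=
  fun k => systemOutput g u (((k : ℝ) + 1) * h) + v k

/-- Regression matrix. Columns are indexed by the lags `n = -Mnc, …, Mc`; the entry in the row of
time `k h` (`k = 1, …, N`) is `h u((k - n) h)`. -/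
def regressor (h : ℝ) (Mnc Mc : ℤ) (u : ℝ → ℝ) (N : ℕ) :
    Matrix (Fin N) (Finset.Icc (-Mnc) Mc) ℝ :=
  Matrix.of fun k n => h * u (((k : ℝ) + 1 - ((n : ℤ) : ℝ)) * h)

/-- Least-squares estimate `(Φᵀ Φ)⁻¹ Φᵀ y`. -/
def leastSquares {m ι : Type*} [Fintype m] [Fintype ι] [DecidableEq ι]
    (Φ : Matrix m ι ℝ) (y : m → ℝ) : ι → ℝ :=
  (Φᵀ * Φ)⁻¹ *ᵥ (Φᵀ *ᵥ y)

/-- True coefficient vector `(g_BL(-Mnc h), …, g_BL(Mc h))`. -/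
def trueCoeff (h : ℝ) (Mnc Mc : ℤ) (g : ℝ → ℝ) : Finset.Icc (-Mnc) Mc → ℝ :=
  fun n => gBL h g n

variable {Ω : Type*} [MeasurableSpace Ω]

/-- White noise with variance `lam ^ 2`: independent, identically distributed, square-integrable,
zero-mean random variables. -/
structure IsWhiteNoise (e : ℕ → Ω → ℝ) (lam : ℝ) (P : Measure Ω) : Prop where
  measurable : ∀ n, Measurable (e n)
  indep : iIndepFun e P
  identDistrib : ∀ n, IdentDistrib (e n) (e 0) P P
  memLp : ∀ n, MemLp (e n) 2 P
  mean_zero : ∀ n, ∫ ω, e n ω ∂P = 0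
  variance_eq : ∀ n, variance (e n) P = lam ^ 2

/-- A zero-mean stochastic process with constant finite variance `sigma ^ 2` (no assumption on the
dependence between different times). -/
structure IsZeroMeanProcess (v : ℕ → Ω → ℝ) (sigma : ℝ) (P : Measure Ω) : Prop where
  measurable : ∀ k, Measurable (v k)
  memLp : ∀ k, MemLp (v k) 2 P
  mean_zero : ∀ k, ∫ ω, v k ω ∂P = 0
  variance_eq : ∀ k, variance (v k) P = sigma ^ 2

end BandLimited

end

/-! Since `nsinc` is a unit impulse on the integers, the sampled input is `e` cut to `N` terms, so
`Φ` has entries `h * e (k - n)`, and on the grid the system is exactly convolution with `b = h *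
gBL`. Consistency follows from two limits for the normal equations: `ΦᵀΦ / N → h² λ² I` and `Φᵀy / N
→ h² λ² ρ*`. Whiteness makes the first limit a multiple of the identity, so the lags left out of the
model cause no bias.

Both limits are correlations of `e` with a square-summable filtering of `e`
(`IsWhiteNoise.ae_tendsto_crossCorrelation`), plus a noise term
(`IsWhiteNoise.ae_tendsto_noiseCorrelation`). The diagonal of the quadratic form obeys the classical
strong law. Off the diagonal, grouping by the larger index gives terms `e j * (past)`, which are
orthogonal and, by independence, bounded in L² without fourth moments; `strong_law_of_orthogonal`
applies. Cutting to `N` samples costs a bounded number of terms. Square-summability of `b` is a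
duality argument (`exists_sum_gBL_sq_le`). -/

noncomputable section

namespace BandLimited

/-! ### Strong laws from second moments -/

section SecondMoments

variable {Ω : Type*} [MeasurableSpace Ω] {P : Measure Ω}

/-- Random variables with summable second moments converge to zero almost surely. -/
theorem ae_tendsto_zero_of_summable_sq {Y : ℕ → Ω → ℝ} {c : ℕ → ℝ}
    (hY : ∀ n, MemLp (Y n) 2 P) (hc : ∀ n, ∫ ω, Y n ω ^ 2 ∂P ≤ c n) (hs : Summable c) :
    ∀ᵐ ω ∂P, Tendsto (fun n => Y n ω) atTop (𝓝 0) := by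
  have hc0 : ∀ n, 0 ≤ c n := fun n => (integral_nonneg fun _ => sq_nonneg _).trans (hc n)
  have hm : ∀ n, AEMeasurable (fun ω => ENNReal.ofReal (Y n ω ^ 2)) P := fun n =>
    ((hY n).aestronglyMeasurable.aemeasurable.pow_const 2).ennreal_ofReal
  have hfin : ∫⁻ ω, ∑' n, ENNReal.ofReal (Y n ω ^ 2) ∂P ≠ ⊤ := by
    rw [lintegral_tsum hm]
    refine ne_top_of_le_ne_top (hs.tsum_ofReal_ne_top) (ENNReal.tsum_le_tsum fun n => ?_)
    rw [← ofReal_integral_eq_lintegral_ofReal (hY n).integrable_sq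
      (Eventually.of_forall fun _ => sq_nonneg _)]
    exact ENNReal.ofReal_le_ofReal (hc n)
  filter_upwards [ae_lt_top' (AEMeasurable.tsum hm) hfin] with ω hω
  have h1 := ENNReal.tendsto_atTop_zero_of_tsum_ne_top hω.ne
  have h2 : Tendsto (fun n => Y n ω ^ 2) atTop (𝓝 0) := by
    have := (ENNReal.tendsto_toReal ENNReal.zero_ne_top).comp h1
    simpa [Function.comp_def, ENNReal.toReal_ofReal (sq_nonneg _)] using this
  have h3 := h2.sqrt
  simp only [Real.sqrt_sq_eq_abs, Real.sqrt_zero] at h3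
  exact (tendsto_zero_iff_abs_tendsto_zero _).2 h3

theorem ae_tendsto_div_of_sq_le {Y : ℕ → Ω → ℝ} {C : ℝ}
    (hY : ∀ n, MemLp (Y n) 2 P) (hC : ∀ n, ∫ ω, Y n ω ^ 2 ∂P ≤ C) :
    ∀ᵐ ω ∂P, Tendsto (fun n : ℕ => Y n ω / n) atTop (𝓝 0) := by
  refine ae_tendsto_zero_of_summable_sq (c := fun n : ℕ => C * (1 / (n : ℝ) ^ 2)) (fun n => ?_)
    (fun n => ?_) ((Real.summable_one_div_nat_pow.2 one_lt_two).mul_left C)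
  · simpa [div_eq_mul_inv] using (hY n).mul_const ((n : ℝ)⁻¹)
  · simp_rw [div_pow]
    rw [integral_div, div_eq_mul_one_div]
    exact mul_le_mul_of_nonneg_right (hC n) (by positivity)

/-- Cauchy–Schwarz alone, hence `card²` rather than `card`: it serves families with no
orthogonality, namely absolute values and boundary terms. -/
theorem integral_sq_sum_le {ι : Type*} {X : ι → Ω → ℝ} {C : ℝ} (s : Finset ι)
    (hX : ∀ i ∈ s, MemLp (X i) 2 P) (hC : ∀ i ∈ s, ∫ ω, X i ω ^ 2 ∂P ≤ C) :
    ∫ ω, (∑ i ∈ s, X i ω) ^ 2 ∂P ≤ (s.card : ℝ) ^ 2 * C := by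
  calc ∫ ω, (∑ i ∈ s, X i ω) ^ 2 ∂P ≤ ∫ ω, (s.card : ℝ) * ∑ i ∈ s, X i ω ^ 2 ∂P := by
        refine integral_mono (memLp_finsetSum s hX).integrable_sq
          ((integrable_finsetSum s fun i hi => (hX i hi).integrable_sq).const_mul _)
          fun ω => sq_sum_le_card_mul_sum_sq
    _ = s.card * ∑ i ∈ s, ∫ ω, X i ω ^ 2 ∂P := by
        rw [integral_const_mul, integral_finsetSum s fun i hi => (hX i hi).integrable_sq]
    _ ≤ s.card * (s.card * C) := by
        gcongr
        simpa using Finset.sum_le_sum hC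
    _ = _ := by ring

/-- Pythagoras for orthogonal square-integrable random variables. -/
theorem integral_sq_sum_of_orthogonal {ι : Type*} {X : ι → Ω → ℝ} (s : Finset ι)
    (hX : ∀ i ∈ s, MemLp (X i) 2 P)
    (ho : ∀ i ∈ s, ∀ j ∈ s, i ≠ j → ∫ ω, X i ω * X j ω ∂P = 0) :
    ∫ ω, (∑ i ∈ s, X i ω) ^ 2 ∂P = ∑ i ∈ s, ∫ ω, X i ω ^ 2 ∂P := by
  have hint : ∀ i ∈ s, ∀ j ∈ s, Integrable (fun ω => X i ω * X j ω) P := fun i hi j hj =>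
    (hX i hi).integrable_mul (hX j hj)
  simp_rw [sq, Finset.sum_mul_sum]
  rw [integral_finsetSum s fun i hi => integrable_finsetSum s fun j hj => hint i hi j hj]
  refine Finset.sum_congr rfl fun i hi => ?_
  rw [integral_finsetSum s fun j hj => hint i hi j hj]
  exact Finset.sum_eq_single_of_mem i hi fun j hj hji => ho i hi j hj hji.symm

/-- Strong law of large numbers for orthogonal random variables with bounded second moments. -/
theorem strong_law_of_orthogonal {X : ℕ → Ω → ℝ} {C : ℝ}
    (hX : ∀ i, MemLp (X i) 2 P) (hC : ∀ i, ∫ ω, X i ω ^ 2 ∂P ≤ C)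
    (ho : ∀ i j, i < j → ∫ ω, X i ω * X j ω ∂P = 0) :
    ∀ᵐ ω ∂P, Tendsto (fun n : ℕ => (∑ i ∈ Finset.range n, X i ω) / n) atTop (𝓝 0) := by
  have hC0 : 0 ≤ C := (integral_nonneg fun _ => sq_nonneg _).trans (hC 0)
  have ho' : ∀ i j, i ≠ j → ∫ ω, X i ω * X j ω ∂P = 0 := by
    intro i j hij
    rcases hij.lt_or_gt with h | h
    · exact ho i j h
    · simpa only [mul_comm] using ho j i h
  have hsum : Summable fun k : ℕ => 1 / (k : ℝ) ^ 2 :=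
    Real.summable_one_div_nat_pow.2 one_lt_two
  -- The mean of `n` terms has second moment at most `C / n`, which is summable only along a
  -- subsequence such as the squares.
  have h1 : ∀ᵐ ω ∂P, Tendsto (fun k : ℕ => (∑ i ∈ Finset.range (k ^ 2), X i ω) / (k : ℝ) ^ 2)
      atTop (𝓝 0) := by
    refine ae_tendsto_zero_of_summable_sq (c := fun k : ℕ => C * (1 / (k : ℝ) ^ 2))
      (fun k => ?_) (fun k => ?_) (hsum.mul_left C)
    · simpa only [div_eq_mul_inv] using
        (memLp_finsetSum (Finset.range (k ^ 2)) fun i _ => hX i).mul_const (((k : ℝ) ^ 2)⁻¹)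
    · simp_rw [div_pow]
      rw [integral_div, integral_sq_sum_of_orthogonal _ (fun i _ => hX i)
        (fun i _ j _ => ho' i j)]
      have h2 : ∑ i ∈ Finset.range (k ^ 2), ∫ ω, X i ω ^ 2 ∂P ≤ (k : ℝ) ^ 2 * C := by
        refine (Finset.sum_le_card_nsmul _ _ C fun i _ => hC i).trans_eq ?_
        rw [Finset.card_range, nsmul_eq_mul]
        push_cast
        rfl
      rcases eq_or_ne k 0 with rfl | hk
      · simp
      have hk' : (0 : ℝ) < k := by positivity
      calc _ ≤ ((k : ℝ) ^ 2 * C) / ((k : ℝ) ^ 2) ^ 2 := by gcongr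
        _ = _ := by field_simp
  -- Between consecutive squares lie `2k + 1 ≤ 3k` terms, so the block contributes at most `(3k)² C
  -- / k⁴`; this is the constant `9 * C`.
  have h2 : ∀ᵐ ω ∂P, Tendsto
      (fun k : ℕ => (∑ i ∈ Finset.Ico (k ^ 2) ((k + 1) ^ 2), |X i ω|) / (k : ℝ) ^ 2)
      atTop (𝓝 0) := by
    refine ae_tendsto_zero_of_summable_sq (c := fun k : ℕ => 9 * C * (1 / (k : ℝ) ^ 2))
      (fun k => ?_) (fun k => ?_) (hsum.mul_left _)
    · have h3 : MemLp (fun ω => ∑ i ∈ Finset.Ico (k ^ 2) ((k + 1) ^ 2), |X i ω|) 2 P :=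
        memLp_finsetSum _ fun i _ => (hX i).abs
      simpa only [div_eq_mul_inv] using h3.mul_const (((k : ℝ) ^ 2)⁻¹)
    · simp_rw [div_pow]
      rw [integral_div]
      have h3 := integral_sq_sum_le (X := fun i ω => |X i ω|) (C := C)
        (Finset.Ico (k ^ 2) ((k + 1) ^ 2)) (fun i _ => (hX i).abs)
        (fun i _ => by simpa only [sq_abs] using hC i)
      have hcard : ((Finset.Ico (k ^ 2) ((k + 1) ^ 2)).card : ℝ) = 2 * k + 1 := by
        rw [Nat.card_Ico, show (k + 1) ^ 2 - k ^ 2 = 2 * k + 1 by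
          rw [show (k + 1) ^ 2 = 2 * k + 1 + k ^ 2 by ring]; simp]
        push_cast; ring
      rw [hcard] at h3
      rcases eq_or_ne k 0 with rfl | hk
      · simp
      have hk' : (1 : ℝ) ≤ k := by exact_mod_cast Nat.one_le_iff_ne_zero.2 hk
      calc _ ≤ ((2 * (k : ℝ) + 1) ^ 2 * C) / ((k : ℝ) ^ 2) ^ 2 := by gcongr
        _ ≤ ((3 * (k : ℝ)) ^ 2 * C) / ((k : ℝ) ^ 2) ^ 2 := by gcongr; linarith
        _ = _ := by field_simp; ring
  filter_upwards [h1, h2] with ω h1 h2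
  have hsqrt : Tendsto Nat.sqrt atTop atTop :=
    tendsto_atTop_atTop.2 fun b => ⟨b * b, fun a ha => Nat.le_sqrt.2 ha⟩
  have h3 : Tendsto (fun n : ℕ =>
      (|∑ i ∈ Finset.range (n.sqrt ^ 2), X i ω| +
        ∑ i ∈ Finset.Ico (n.sqrt ^ 2) ((n.sqrt + 1) ^ 2), |X i ω|) / (n.sqrt : ℝ) ^ 2)
      atTop (𝓝 0) := by
    have := (h1.abs.add h2).comp hsqrt
    simp only [abs_zero, add_zero] at this
    refine this.congr fun n => ?_
    simp [abs_div, add_div]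
  refine squeeze_zero_norm' ?_ h3
  filter_upwards [eventually_ge_atTop 1] with n hn
  have hs1 : n.sqrt ^ 2 ≤ n := Nat.sqrt_le' n
  have hs2 : n < (n.sqrt + 1) ^ 2 := Nat.lt_succ_sqrt' n
  have hs0 : 0 < n.sqrt := Nat.sqrt_pos.2 hn
  rw [Real.norm_eq_abs, abs_div, Nat.abs_cast]
  have hnum : |∑ i ∈ Finset.range n, X i ω| ≤ |∑ i ∈ Finset.range (n.sqrt ^ 2), X i ω| +
        ∑ i ∈ Finset.Ico (n.sqrt ^ 2) ((n.sqrt + 1) ^ 2), |X i ω| := by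
    rw [← Finset.sum_range_add_sum_Ico _ hs1]
    refine (abs_add_le _ _).trans (add_le_add le_rfl ((Finset.abs_sum_le_sum_abs _ _).trans ?_))
    exact Finset.sum_le_sum_of_subset_of_nonneg (Finset.Ico_subset_Ico le_rfl hs2.le)
      fun _ _ _ => abs_nonneg _
  have hden : ((n.sqrt : ℝ)) ^ 2 ≤ n := by exact_mod_cast hs1
  exact div_le_div₀ ((abs_nonneg _).trans hnum) hnum (by positivity) hden

end SecondMoments

/-! ### Edge effects of a shift on a finite window -/

section Truncation

/-- The indices `i < N` for which the shifted index `i + n` also lies in `[0, N)`. -/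
def shiftInner (n : ℤ) (N : ℕ) : Finset ℕ :=
  (Finset.range N).filter fun i => 0 ≤ (i : ℤ) + n ∧ (i : ℤ) + n < N

/-- The indices `i < N` for which the shifted index `i + n` falls outside `[0, N)`. -/
def shiftBoundary (n : ℤ) (N : ℕ) : Finset ℕ :=
  (Finset.range N).filter fun i => ¬(0 ≤ (i : ℤ) + n ∧ (i : ℤ) + n < N)

theorem card_shiftBoundary_le (n : ℤ) (N : ℕ) : (shiftBoundary n N).card ≤ 2 * n.natAbs := by
  have : shiftBoundary n N ⊆ Finset.range n.natAbs ∪ Finset.Ico (N - n.natAbs) N := by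
    intro i
    simp only [shiftBoundary, Finset.mem_filter, Finset.mem_range, Finset.mem_union,
      Finset.mem_Ico]
    omega
  refine (Finset.card_le_card this).trans ((Finset.card_union_le _ _).trans ?_)
  rw [Finset.card_range, Nat.card_Ico]
  omega

theorem sum_shiftInner_add_sum_shiftBoundary (n : ℤ) (N : ℕ) (f : ℕ → ℝ) :
    ∑ i ∈ shiftInner n N, f i + ∑ i ∈ shiftBoundary n N, f i = ∑ i ∈ Finset.range N, f i :=
  Finset.sum_filter_add_sum_filter_not _ _ _

/-- At most `2|n|` terms lie on the boundary, so their sum is bounded in L² and its quotient by `N`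
has second moment `O(1 / N²)`. No relation between different `N` is needed, so `F` may depend on
`N`. -/
theorem ae_tendsto_sum_shiftBoundary {Ω : Type*} [MeasurableSpace Ω] {P : Measure Ω} (n : ℤ)
    {F : ℕ → ℕ → Ω → ℝ} {C : ℝ} (hF : ∀ N i, i < N → MemLp (F N i) 2 P)
    (hC : ∀ N i, i < N → ∫ ω, F N i ω ^ 2 ∂P ≤ C) (hC0 : 0 ≤ C) :
    ∀ᵐ ω ∂P, Tendsto (fun N : ℕ => (∑ i ∈ shiftBoundary n N, F N i ω) / N) atTop (𝓝 0) := by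
  have hlt : ∀ N, ∀ i ∈ shiftBoundary n N, i < N := fun N i hi =>
    Finset.mem_range.1 (Finset.mem_filter.1 hi).1
  refine ae_tendsto_div_of_sq_le (Y := fun N ω => ∑ i ∈ shiftBoundary n N, F N i ω)
    (C := ((2 * n.natAbs : ℕ) : ℝ) ^ 2 * C)
    (fun N => memLp_finsetSum _ fun i hi => hF N i (hlt N i hi)) fun N => ?_
  refine (integral_sq_sum_le _ (fun i hi => hF N i (hlt N i hi))
    fun i hi => hC N i (hlt N i hi)).trans ?_
  gcongr
  exact card_shiftBoundary_le n N

theorem tendsto_sum_shiftInner_div (n : ℤ) {s : ℕ → ℝ} {L : ℝ}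
    (hs : Tendsto (fun N : ℕ => (∑ i ∈ Finset.range N, s i) / N) atTop (𝓝 L)) :
    Tendsto (fun N : ℕ => (∑ i ∈ shiftInner n N, s i) / N) atTop (𝓝 L) := by
  rcases le_total 0 n with hn | hn
  · obtain ⟨m, rfl⟩ := Int.eq_ofNat_of_zero_le hn
    have h1 : ∀ N, shiftInner m N = Finset.range (N - m) := by
      intro N; ext i
      simp only [shiftInner, Finset.mem_filter, Finset.mem_range]
      omega
    have h2 : Tendsto (fun N : ℕ => (((N - m : ℕ) : ℝ)) / N) atTop (𝓝 1) := by
      have : Tendsto (fun N : ℕ => 1 - (m : ℝ) / N) atTop (𝓝 (1 - 0)) :=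
        tendsto_const_nhds.sub (tendsto_const_div_atTop_nhds_zero_nat _)
      rw [sub_zero] at this
      refine this.congr' ?_
      filter_upwards [eventually_ge_atTop (m + 1)] with N hN
      have hN0 : (N : ℝ) ≠ 0 := by
        have : N ≠ 0 := by omega
        exact_mod_cast this
      rw [Nat.cast_sub (by omega), sub_div, div_self hN0]
    have h3 := (hs.comp (tendsto_sub_atTop_nat m)).mul h2
    rw [mul_one] at h3
    refine h3.congr' ?_
    filter_upwards [eventually_ge_atTop (m + 1)] with N hN
    have hN0 : ((N - m : ℕ) : ℝ) ≠ 0 := by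
      have : N - m ≠ 0 := by omega
      exact_mod_cast this
    simp only [Function.comp_apply, h1]
    field_simp
  · obtain ⟨m, hm⟩ := Int.eq_ofNat_of_zero_le (neg_nonneg.2 hn)
    have h3 : Tendsto (fun N : ℕ => (∑ i ∈ Finset.range N, s i) / N -
        (∑ i ∈ Finset.range m, s i) / N) atTop (𝓝 (L - 0)) :=
      hs.sub (tendsto_const_div_atTop_nhds_zero_nat _)
    rw [sub_zero] at h3
    refine h3.congr' ?_
    filter_upwards [eventually_ge_atTop m] with N hN
    have h1 : shiftInner n N = Finset.Ico m N := by
      ext i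
      simp only [shiftInner, Finset.mem_filter, Finset.mem_range, Finset.mem_Ico]
      omega
    rw [h1, ← sub_div, ← Finset.sum_range_add_sum_Ico s hN]
    ring

end Truncation

/-! ### Correlations of white noise -/

section WhiteNoise

variable {Ω : Type*} [MeasurableSpace Ω] {P : Measure Ω}

theorem memLp_two_mul_of_indepFun {X Y : Ω → ℝ} (hX : MemLp X 2 P) (hY : MemLp Y 2 P)
    (h : IndepFun X Y P) : MemLp (fun ω => X ω * Y ω) 2 P := by
  refine (memLp_two_iff_integrable_sq (hX.aestronglyMeasurable.mul hY.aestronglyMeasurable)).2 ?_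
  simp only [Pi.mul_apply, mul_pow]
  exact (h.comp (measurable_id.pow_const 2) (measurable_id.pow_const 2)).integrable_mul
    hX.integrable_sq hY.integrable_sq

theorem integral_sq_mul_of_indepFun {X Y : Ω → ℝ} (hX : MemLp X 2 P) (hY : MemLp Y 2 P)
    (h : IndepFun X Y P) :
    ∫ ω, (X ω * Y ω) ^ 2 ∂P = (∫ ω, X ω ^ 2 ∂P) * ∫ ω, Y ω ^ 2 ∂P := by
  simp_rw [mul_pow]
  exact (h.comp (measurable_id.pow_const 2) (measurable_id.pow_const 2)).integral_fun_mul_eq_mul_integral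
    hX.integrable_sq.aestronglyMeasurable hY.integrable_sq.aestronglyMeasurable

theorem IsZeroMeanProcess.integral_sq {v : ℕ → Ω → ℝ} {sigma : ℝ}
    (hv : IsZeroMeanProcess v sigma P) (k : ℕ) : ∫ ω, v k ω ^ 2 ∂P = sigma ^ 2 := by
  rw [← hv.variance_eq k,
    variance_of_integral_eq_zero (hv.measurable k).aemeasurable (hv.mean_zero k)]

namespace IsWhiteNoise

variable {e : ℕ → Ω → ℝ} {lam : ℝ}

theorem integral_sq (he : IsWhiteNoise e lam P) (i : ℕ) : ∫ ω, e i ω ^ 2 ∂P = lam ^ 2 := by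
  rw [← he.variance_eq i,
    variance_of_integral_eq_zero (he.measurable i).aemeasurable (he.mean_zero i)]

theorem indepFun_of_notMem (he : IsWhiteNoise e lam P) {i : ℕ} {T : Finset ℕ} (hi : i ∉ T)
    {f : (T → ℝ) → ℝ} (hf : Measurable f) :
    IndepFun (e i) (fun ω => f fun m => e m ω) P := by
  have h := he.indep.indepFun_finset {i} T (Finset.disjoint_singleton_left.2 hi) he.measurable
  let φ : (({i} : Finset ℕ) → ℝ) → ℝ := fun x => x ⟨i, Finset.mem_singleton_self i⟩
  have hφ : Measurable φ := measurable_pi_apply _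
  exact h.comp hφ hf

theorem integral_mul_eq_zero (he : IsWhiteNoise e lam P) {i j : ℕ} (hij : i ≠ j) :
    ∫ ω, e i ω * e j ω ∂P = 0 := by
  rw [(he.indep.indepFun hij).integral_fun_mul_eq_mul_integral
    (he.measurable i).aestronglyMeasurable (he.measurable j).aestronglyMeasurable, he.mean_zero,
    zero_mul]

theorem memLp_sum (he : IsWhiteNoise e lam P) (T : Finset ℕ) (c : ℕ → ℝ) :
    MemLp (fun ω => ∑ m ∈ T, e m ω * c m) 2 P :=
  memLp_finsetSum T fun m _ => (he.memLp m).mul_const (c m)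

theorem integral_sq_sum (he : IsWhiteNoise e lam P) (T : Finset ℕ) (c : ℕ → ℝ) :
    ∫ ω, (∑ m ∈ T, e m ω * c m) ^ 2 ∂P = lam ^ 2 * ∑ m ∈ T, c m ^ 2 := by
  rw [integral_sq_sum_of_orthogonal T fun m _ => (he.memLp m).mul_const (c m)]
  · rw [Finset.mul_sum]
    refine Finset.sum_congr rfl fun m _ => ?_
    simp_rw [mul_pow]
    rw [integral_mul_const, he.integral_sq]
  · intro i _ j _ hij
    have : ∀ ω, e i ω * c i * (e j ω * c j) = e i ω * e j ω * (c i * c j) := fun ω => by ring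
    simp_rw [this]
    rw [integral_mul_const, he.integral_mul_eq_zero hij, zero_mul]

theorem indepFun_sum (he : IsWhiteNoise e lam P) {i : ℕ} {T : Finset ℕ} (hi : i ∉ T)
    (c : ℕ → ℝ) : IndepFun (e i) (fun ω => ∑ m ∈ T, e m ω * c m) P := by
  have h := he.indepFun_of_notMem hi (f := fun x => ∑ m : T, x m * c m) (by fun_prop)
  convert h using 2 with ω
  exact (Finset.sum_coe_sort T fun m => e m ω * c m).symm

theorem memLp_mul_sum (he : IsWhiteNoise e lam P) {i : ℕ} {T : Finset ℕ} (hi : i ∉ T)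
    (c : ℕ → ℝ) : MemLp (fun ω => e i ω * ∑ m ∈ T, e m ω * c m) 2 P :=
  memLp_two_mul_of_indepFun (he.memLp i) (he.memLp_sum T c) (he.indepFun_sum hi c)

theorem integral_sq_mul_sum (he : IsWhiteNoise e lam P) {i : ℕ} {T : Finset ℕ} (hi : i ∉ T)
    (c : ℕ → ℝ) :
    ∫ ω, (e i ω * ∑ m ∈ T, e m ω * c m) ^ 2 ∂P = lam ^ 4 * ∑ m ∈ T, c m ^ 2 := by
  rw [integral_sq_mul_of_indepFun (he.memLp i) (he.memLp_sum T c) (he.indepFun_sum hi c),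
    he.integral_sq, he.integral_sq_sum]
  ring

/-- Every factor other than `e j` is a function of the variables with index below `j`, hence
independent of the centred `e j`. -/
theorem integral_increment_mul_eq_zero (he : IsWhiteNoise e lam P) (c : ℕ → ℕ → ℝ) {i j : ℕ}
    (hij : i < j) :
    ∫ ω, (e i ω * ∑ m ∈ Finset.range i, e m ω * c i m) *
      (e j ω * ∑ m ∈ Finset.range j, e m ω * c j m) ∂P = 0 := by
  have hj : j ∉ Finset.range j := by simp
  let f : (Finset.range j → ℝ) → ℝ := fun x =>
    (x ⟨i, Finset.mem_range.2 hij⟩ * ∑ m : Finset.range i,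
      x ⟨m, Finset.mem_range.2 ((Finset.mem_range.1 m.2).trans hij)⟩ * c i m) *
      ∑ m : Finset.range j, x m * c j m
  have hf : Measurable f := by fun_prop
  have h := he.indepFun_of_notMem hj hf
  have hrw : ∀ ω, (e i ω * ∑ m ∈ Finset.range i, e m ω * c i m) *
      (e j ω * ∑ m ∈ Finset.range j, e m ω * c j m) = e j ω * f fun m => e m ω := by
    intro ω
    simp only [f]
    rw [Finset.sum_coe_sort (Finset.range i) fun m => e m ω * c i m,
      Finset.sum_coe_sort (Finset.range j) fun m => e m ω * c j m]
    ring
  simp_rw [hrw]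
  rw [h.integral_fun_mul_eq_mul_integral (he.measurable j).aestronglyMeasurable
    (hf.comp (measurable_pi_lambda _ fun m => he.measurable m)).aestronglyMeasurable,
    he.mean_zero, zero_mul]

/-- Strong law of large numbers for quadratic forms in white noise without diagonal, written as
sums of martingale increments. -/
theorem strong_law_increments (he : IsWhiteNoise e lam P) (c : ℕ → ℕ → ℝ) {C : ℝ}
    (hc : ∀ j, ∑ m ∈ Finset.range j, c j m ^ 2 ≤ C) :
    ∀ᵐ ω ∂P, Tendsto (fun N : ℕ => (∑ j ∈ Finset.range N,
      e j ω * ∑ m ∈ Finset.range j, e m ω * c j m) / N) atTop (𝓝 0) := by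
  have hj : ∀ j, j ∉ Finset.range j := by simp
  refine strong_law_of_orthogonal (X := fun j ω => e j ω * ∑ m ∈ Finset.range j, e m ω * c j m)
    (C := lam ^ 4 * C) (fun j => he.memLp_mul_sum (hj j) (c j)) (fun j => ?_)
    (fun i j hij => he.integral_increment_mul_eq_zero c hij)
  rw [he.integral_sq_mul_sum (hj j)]
  gcongr
  exact hc j

theorem strong_law_sq (he : IsWhiteNoise e lam P) :
    ∀ᵐ ω ∂P, Tendsto (fun N : ℕ => (∑ i ∈ Finset.range N, e i ω ^ 2) / N) atTop
      (𝓝 (lam ^ 2)) := by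
  have h := strong_law_ae_real (fun i ω => e i ω ^ 2) (he.memLp 0).integrable_sq
    (fun i j hij => (he.indep.indepFun hij).comp (measurable_id.pow_const 2)
      (measurable_id.pow_const 2))
    (fun i => (he.identDistrib i).comp (measurable_id.pow_const 2))
  rwa [he.integral_sq 0] at h

end IsWhiteNoise

/-- Regroups ordered off-diagonal pairs by their larger index, which turns a quadratic form into a
sum of increments that do not depend on `N`. -/
theorem sum_sum_erase_range (c : ℕ → ℕ → ℝ) (N : ℕ) :
    ∑ i ∈ Finset.range N, ∑ m ∈ (Finset.range N).erase i, c i m =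
      ∑ j ∈ Finset.range N, ∑ m ∈ Finset.range j, (c j m + c m j) := by
  induction N with
  | zero => simp
  | succ N ih =>
    rw [Finset.sum_range_succ, Finset.sum_range_succ _ N, ← ih, Finset.range_add_one,
      Finset.erase_insert (by simp), Finset.sum_add_distrib, add_left_comm, add_comm]
    congr 1
    rw [add_comm, ← Finset.sum_add_distrib]
    refine Finset.sum_congr rfl fun i hi => ?_
    have hiN : i < N := Finset.mem_range.1 hi
    rw [Finset.erase_insert_of_ne (by omega), Finset.sum_insert (by simp), add_comm]

/-- The response of a discrete-time filter `b` to the finite input `e 0, …, e (N - 1)`. -/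
def filterOutput (b : ℤ → ℝ) (N : ℕ) (e : ℕ → ℝ) (z : ℤ) : ℝ :=
  ∑ m ∈ Finset.range N, e m * b (z - m)

/-- The finite input `e 0, …, e (N - 1)`, extended by zero to all integer times. -/
def truncated (N : ℕ) (e : ℕ → ℝ) (z : ℤ) : ℝ :=
  ∑ m ∈ Finset.range N, if (m : ℤ) = z then e m else 0

theorem sum_truncated_mul (N : ℕ) (e : ℕ → ℝ) (n : ℤ) (x : ℤ → ℝ) :
    ∑ k ∈ Finset.range N, truncated N e (k - n) * x k =
      ∑ i ∈ shiftInner n N, e i * x (i + n) := by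
  simp_rw [truncated, Finset.sum_mul]
  rw [Finset.sum_comm, shiftInner, Finset.sum_filter]
  refine Finset.sum_congr rfl fun i _ => ?_
  have h : ∀ k : ℕ, (if (i : ℤ) = k - n then e i else 0) * x k =
      if (k : ℤ) = i + n then e i * x (i + n) else 0 := by
    intro k
    by_cases hk : (k : ℤ) = i + n
    · rw [if_pos hk, if_pos (by omega), hk]
    · rw [if_neg hk, if_neg (by omega), zero_mul]
  simp_rw [h]
  split_ifs with hi
  · rw [Finset.sum_eq_single_of_mem (((i : ℤ) + n).toNat) (Finset.mem_range.2 (by omega)),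
      if_pos (by omega)]
    intro k _ hk
    rw [if_neg (by omega)]
  · refine Finset.sum_eq_zero fun k hk => ?_
    have := Finset.mem_range.1 hk
    rw [if_neg (by omega)]

theorem sum_sq_comp_le {b : ℤ → ℝ} {C : ℝ} (hb : ∀ s : Finset ℤ, ∑ j ∈ s, b j ^ 2 ≤ C)
    (T : Finset ℕ) (f : ℕ → ℤ) (hf : Function.Injective f) : ∑ m ∈ T, b (f m) ^ 2 ≤ C := by
  have := hb (T.image f)
  rwa [Finset.sum_image fun x _ y _ h => hf h] at this

/-- Strong law for the empirical cross-correlation of white noise with its filtered version. -/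
theorem IsWhiteNoise.ae_tendsto_crossCorrelation {e : ℕ → Ω → ℝ} {lam : ℝ}
    (he : IsWhiteNoise e lam P) {b : ℤ → ℝ} {C : ℝ}
    (hb : ∀ s : Finset ℤ, ∑ j ∈ s, b j ^ 2 ≤ C) (n : ℤ) :
    ∀ᵐ ω ∂P, Tendsto (fun N : ℕ => (∑ k ∈ Finset.range N, truncated N (fun i => e i ω) (k - n) *
      filterOutput b N (fun i => e i ω) k) / N) atTop (𝓝 (lam ^ 2 * b n)) := by
  have hC : 0 ≤ C := by simpa using hb ∅
  let F : ℕ → ℕ → Ω → ℝ := fun N i ω =>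
    e i ω * ∑ m ∈ (Finset.range N).erase i, e m ω * b (i + n - m)
  have hF1 : ∀ N i, i < N → MemLp (F N i) 2 P := fun N i _ =>
    he.memLp_mul_sum (Finset.notMem_erase i _) fun m => b (i + n - m)
  have hF2 : ∀ N i, i < N → ∫ ω, F N i ω ^ 2 ∂P ≤ lam ^ 4 * C := fun N i _ => by
    rw [he.integral_sq_mul_sum (Finset.notMem_erase i _) fun m => b (i + n - m)]
    gcongr
    exact sum_sq_comp_le hb _ _ fun x y h => by simpa using h
  have hboundary := ae_tendsto_sum_shiftBoundary n hF1 hF2 (by positivity)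
  -- Each pair `m < j` occurs in both orders, whence the two coefficients; `(x + y)² ≤ 2x² + 2y²`
  -- gives `4 * C`.
  have hfull := he.strong_law_increments (fun j m => b (j + n - m) + b (m + n - j)) (C := 4 * C)
    fun j => by
      have h1 := sum_sq_comp_le hb (Finset.range j) (fun m => j + n - m) fun x y h => by
        simpa using h
      have h2 := sum_sq_comp_le hb (Finset.range j) (fun m => m + n - j) fun x y h => by
        simpa using h
      calc _ ≤ ∑ m ∈ Finset.range j, (2 * b (j + n - m) ^ 2 + 2 * b (m + n - j) ^ 2) :=
            Finset.sum_le_sum fun m _ => by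
              nlinarith [sq_nonneg (b (j + n - m) - b (m + n - j))]
        _ ≤ 4 * C := by
            rw [Finset.sum_add_distrib, ← Finset.mul_sum, ← Finset.mul_sum]
            linarith
  filter_upwards [hboundary, hfull, he.strong_law_sq] with ω h1 h2 h3
  -- The correlation is the inner diagonal, with coefficient `b n`, plus the full off-diagonal sum
  -- minus its boundary rows.
  have h4 := ((tendsto_sum_shiftInner_div n h3).mul_const (b n)).add (h2.sub h1)
  rw [sub_zero, add_zero] at h4
  refine h4.congr fun N => ?_
  have h5 : ∑ j ∈ Finset.range N, e j ω * ∑ m ∈ Finset.range j,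
      e m ω * (b (j + n - m) + b (m + n - j)) = ∑ i ∈ Finset.range N, F N i ω := by
    simp only [F, Finset.mul_sum]
    rw [sum_sum_erase_range fun i m => e i ω * (e m ω * b (i + n - m))]
    refine Finset.sum_congr rfl fun j _ => Finset.sum_congr rfl fun m _ => ?_
    ring
  rw [h5, sum_truncated_mul, ← sum_shiftInner_add_sum_shiftBoundary n N, ← sub_div,
    add_sub_cancel_right, div_mul_eq_mul_div, ← add_div, Finset.sum_mul, ← Finset.sum_add_distrib]
  congr 1
  refine Finset.sum_congr rfl fun i hi => ?_
  have hi' : i ∈ Finset.range N := (Finset.mem_filter.1 hi).1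
  rw [filterOutput, ← Finset.add_sum_erase _ _ hi']
  simp only [F, add_sub_cancel_left]
  ring

/-- Strong law for the empirical correlation of white noise with an independent process. -/
theorem IsWhiteNoise.ae_tendsto_noiseCorrelation {e v : ℕ → Ω → ℝ} {lam sigma : ℝ}
    (he : IsWhiteNoise e lam P) (hv : IsZeroMeanProcess v sigma P)
    (hev : IndepFun (fun ω n => e n ω) (fun ω k => v k ω) P) (n : ℤ) :
    ∀ᵐ ω ∂P, Tendsto (fun N : ℕ => (∑ k ∈ Finset.range N,
      truncated N (fun i => e i ω) (k - n) * v k ω) / N) atTop (𝓝 0) := by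
  -- At negative times `w` takes the value `v 0`. This occurs only at boundary indices, which are
  -- subtracted again, and keeps the L² bounds uniform.
  let w : ℤ → Ω → ℝ := fun z => v z.toNat
  let X : ℕ → Ω → ℝ := fun i ω => e i ω * w (i + n) ω
  have hind : ∀ i k, IndepFun (e i) (v k) P := fun i k =>
    hev.comp (measurable_pi_apply i) (measurable_pi_apply k)
  have hX1 : ∀ i, MemLp (X i) 2 P := fun i =>
    memLp_two_mul_of_indepFun (he.memLp i) (hv.memLp _) (hind _ _)
  have hX2 : ∀ i, ∫ ω, X i ω ^ 2 ∂P ≤ lam ^ 2 * sigma ^ 2 := fun i => by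
    rw [integral_sq_mul_of_indepFun (he.memLp i) (hv.memLp _) (hind _ _), he.integral_sq,
      hv.integral_sq]
  -- However `v` is correlated in time, its factor splits off by independence and `e i`, `e j` are
  -- orthogonal.
  have ho : ∀ i j, i < j → ∫ ω, X i ω * X j ω ∂P = 0 := by
    intro i j hij
    have h := hev.comp (φ := fun x => x i * x j)
      (ψ := fun x => x ((i : ℤ) + n).toNat * x ((j : ℤ) + n).toNat) (by fun_prop) (by fun_prop)
    have hrw : ∀ ω, X i ω * X j ω = (e i ω * e j ω) * (w (i + n) ω * w (j + n) ω) :=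
      fun ω => by simp only [X]; ring
    simp_rw [hrw]
    refine (h.integral_fun_mul_eq_mul_integral
      ((he.measurable i).mul (he.measurable j)).aestronglyMeasurable
      ((hv.measurable _).mul (hv.measurable _)).aestronglyMeasurable).trans ?_
    rw [show (∫ ω, ((fun x : ℕ → ℝ => x i * x j) ∘ fun ω n => e n ω) ω ∂P) = 0 from
      he.integral_mul_eq_zero hij.ne, zero_mul]
  filter_upwards [strong_law_of_orthogonal hX1 hX2 ho,
    ae_tendsto_sum_shiftBoundary n (F := fun _ => X) (fun _ i _ => hX1 i) (fun _ i _ => hX2 i)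
      (by positivity)] with ω h1 h2
  have h3 := h1.sub h2
  rw [sub_zero] at h3
  refine h3.congr fun N => ?_
  rw [← sub_div, ← sum_shiftInner_add_sum_shiftBoundary n N, add_sub_cancel_right]
  have := sum_truncated_mul N (fun i => e i ω) n fun z => w z ω
  simp only [w, Int.toNat_natCast] at this
  rw [this]

end WhiteNoise

/-! ### Square sums of the sinc function -/

section Sinc

theorem abs_nsinc_le_one (t : ℝ) : |nsinc t| ≤ 1 := Real.abs_sinc_le_one _

theorem continuous_nsinc : Continuous nsinc :=
  Real.continuous_sinc.comp (continuous_const.mul continuous_id)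

theorem nsinc_intCast (z : ℤ) : nsinc z = if z = 0 then 1 else 0 := by
  split_ifs with hz
  · simp [nsinc, hz]
  · have : Real.pi * (z : ℝ) ≠ 0 := mul_ne_zero Real.pi_ne_zero (by exact_mod_cast hz)
    rw [nsinc, Real.sinc_of_ne_zero this, mul_comm, Real.sin_int_mul_pi, zero_div]

theorem nsinc_sq_le (x : ℝ) : nsinc x ^ 2 ≤ 2 / (1 + x ^ 2) := by
  have h1 : nsinc x ^ 2 ≤ 1 := (sq_le_one_iff_abs_le_one _).2 (abs_nsinc_le_one x)
  have h2 : nsinc x * (Real.pi * x) = Real.sin (Real.pi * x) := by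
    by_cases hx : Real.pi * x = 0
    · simp [hx]
    · rw [nsinc, Real.sinc_of_ne_zero hx, div_mul_cancel₀ _ hx]
  have h3 : nsinc x ^ 2 * x ^ 2 * Real.pi ^ 2 ≤ 1 := by
    calc _ = Real.sin (Real.pi * x) ^ 2 := by rw [← h2]; ring
      _ ≤ 1 := Real.sin_sq_le_one _
  have h4 : 1 ≤ Real.pi ^ 2 := by nlinarith [Real.pi_gt_three]
  have h5 : nsinc x ^ 2 * x ^ 2 ≤ 1 := (le_mul_of_one_le_right (by positivity) h4).trans h3
  rw [le_div_iff₀ (by positivity)]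
  linarith

/-- The square sums of integer translates of `nsinc` are bounded uniformly in the translation. -/
theorem exists_sum_nsinc_sq_le :
    ∃ K : ℝ, ∀ (s : Finset ℤ) (t : ℝ), ∑ j ∈ s, nsinc (j - t) ^ 2 ≤ K := by
  have hsum : Summable fun j : ℤ => 4 / (1 + (j : ℝ) ^ 2) := by
    -- The comparison with `4 / j²` fails at `j = 0`, where division by zero gives `0`.
    refine Summable.of_norm_bounded_eventually
      ((Real.summable_one_div_int_pow.2 one_lt_two).mul_left 4) ?_
    rw [Filter.eventually_cofinite]
    refine (Set.finite_singleton (0 : ℤ)).subset fun j hj => ?_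
    by_contra hj0
    have hj' : (0 : ℝ) < (j : ℝ) ^ 2 := by
      have : (j : ℝ) ≠ 0 := by exact_mod_cast hj0
      positivity
    refine hj ?_
    rw [Real.norm_of_nonneg (by positivity), mul_one_div]
    exact div_le_div_of_nonneg_left (by norm_num) hj' (by linarith)
  refine ⟨∑' j : ℤ, 4 / (1 + (j : ℝ) ^ 2), fun s t => ?_⟩
  calc ∑ j ∈ s, nsinc (j - t) ^ 2
      ≤ ∑ j ∈ s, 4 / (1 + ((j - round t : ℤ) : ℝ) ^ 2) := by
        refine Finset.sum_le_sum fun j _ => (nsinc_sq_le _).trans ?_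
        -- Moving `t` to the nearest integer shifts the argument by at most `1/2`, which at most
        -- doubles `1 + x²`; hence `4` in place of `2`.
        rw [div_le_div_iff₀ (by positivity) (by positivity)]
        have h := abs_le.1 (abs_sub_round t)
        push_cast
        nlinarith [sq_nonneg ((j : ℝ) - t - (t - round t))]
    _ = ∑ j ∈ s.image fun j => j - round t, 4 / (1 + (j : ℝ) ^ 2) := by
        rw [Finset.sum_image fun x _ y _ h => by simpa using h]
    _ ≤ _ := hsum.sum_le_tsum _ fun j _ => by positivity

end Sinc

/-! ### The sampled system as a discrete-time filter -/

section System

variable {h : ℝ} {g : ℝ → ℝ}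

theorem integrableOn_mul_nsinc (hg : StableImpulseResponse g) (h : ℝ) (z : ℤ) :
    IntegrableOn (fun τ => g τ * nsinc ((z * h - τ) / h)) (Set.Ioi 0) := by
  refine Integrable.mul_bdd (c := 1) hg ?_ (Eventually.of_forall fun τ => abs_nsinc_le_one _)
  exact (continuous_nsinc.comp (by fun_prop)).aestronglyMeasurable

theorem mul_gBL (hh : 0 < h) (z : ℤ) :
    h * gBL h g z = ∫ τ in Set.Ioi (0 : ℝ), g τ * nsinc ((z * h - τ) / h) := by
  rw [gBL, ← mul_assoc, mul_one_div_cancel hh.ne', one_mul]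

/-- The sampled band-limited impulse response of a stable system is square-summable. -/
theorem exists_sum_gBL_sq_le (hh : 0 < h) (hg : StableImpulseResponse g) :
    ∃ C : ℝ, ∀ s : Finset ℤ, ∑ j ∈ s, (h * gBL h g j) ^ 2 ≤ C := by
  obtain ⟨K, hK⟩ := exists_sum_nsinc_sq_le
  have hK0 : 0 ≤ K := by simpa using hK ∅ 0
  set G : ℝ := ∫ τ in Set.Ioi (0 : ℝ), |g τ|
  have hG : 0 ≤ G := integral_nonneg fun _ => abs_nonneg _
  refine ⟨(G * √K) ^ 2, fun s => ?_⟩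
  set b : ℤ → ℝ := fun j => h * gBL h g j
  set β : ℝ := ∑ j ∈ s, b j ^ 2
  have hβ : 0 ≤ β := Finset.sum_nonneg fun _ _ => sq_nonneg _
  have hint : ∀ j ∈ s, Integrable (fun τ => b j * (g τ * nsinc ((j * h - τ) / h)))
      (volume.restrict (Set.Ioi 0)) := fun j _ => (integrableOn_mul_nsinc hg h j).const_mul _
  -- Duality: one factor `b j` is expanded as an integral. Cauchy–Schwarz bounds the remaining sinc
  -- sum by `√K * √β` uniformly in `τ`, so `β ≤ G * √K * √β`, and `√β` can be cancelled.
  have h1 : β = ∫ τ in Set.Ioi (0 : ℝ), ∑ j ∈ s, b j * (g τ * nsinc ((j * h - τ) / h)) := by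
    rw [integral_finsetSum s hint]
    refine Finset.sum_congr rfl fun j _ => ?_
    rw [integral_const_mul, ← mul_gBL hh, sq]
  have h2 : β ≤ G * √K * √β := by
    calc β ≤ ∫ τ in Set.Ioi (0 : ℝ), |g τ| * (√K * √β) := by
          refine h1.trans_le ?_
          refine integral_mono (integrable_finsetSum s hint) (hg.abs.mul_const _) fun τ => ?_
          have h3 : ∑ j ∈ s, b j * (g τ * nsinc ((j * h - τ) / h)) =
              g τ * ∑ j ∈ s, b j * nsinc (j - τ / h) := by
            rw [Finset.mul_sum]
            refine Finset.sum_congr rfl fun j _ => ?_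
            rw [sub_div, mul_div_cancel_right₀ _ hh.ne']
            ring
          have h4 : |∑ j ∈ s, b j * nsinc (j - τ / h)| ≤ √K * √β := by
            rw [← Real.sqrt_mul hK0]
            refine Real.abs_le_sqrt ((Finset.sum_mul_sq_le_sq_mul_sq _ _ _).trans ?_)
            rw [mul_comm]
            exact mul_le_mul_of_nonneg_right (hK s _) hβ
          simp only [h3]
          refine (le_abs_self _).trans ?_
          rw [abs_mul]
          exact mul_le_mul_of_nonneg_left h4 (abs_nonneg _)
      _ = G * √K * √β := by rw [integral_mul_const, mul_assoc]
  have h5 := Real.sq_sqrt hβ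
  have h6 := Real.sqrt_nonneg β
  have h7 : 0 ≤ G * √K := by positivity
  have h8 : √β ≤ G * √K := by
    by_contra hlt
    push Not at hlt
    nlinarith
  rw [← h5]
  exact pow_le_pow_left₀ h6 h8 2

theorem sincInput_int_mul (hh : 0 < h) (N : ℕ) (e : ℕ → ℝ) (z : ℤ) :
    sincInput h N e (((z : ℝ) + 1) * h) = truncated N e z := by
  refine Finset.sum_congr rfl fun n _ => ?_
  have h1 : (((z : ℝ) + 1) * h - ((n : ℝ) + 1) * h) / h = ((z - n : ℤ) : ℝ) := by
    push_cast
    field_simp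
    ring
  rw [h1, nsinc_intCast]
  by_cases hz : (n : ℤ) = z
  · rw [if_pos (by omega), if_pos hz, mul_one]
  · rw [if_neg (by omega), if_neg hz, mul_zero]

/-- A delay is a filter with a delta response, so the entries of `ΦᵀΦ` fall under the same
cross-correlation law as those of `Φᵀy`. -/
theorem truncated_sub_eq_filterOutput (N : ℕ) (e : ℕ → ℝ) (z n : ℤ) :
    truncated N e (z - n) = filterOutput (fun j => if j = n then 1 else 0) N e z := by
  refine Finset.sum_congr rfl fun m _ => ?_
  beta_reduce
  by_cases hm : (m : ℤ) = z - n
  · rw [if_pos hm, if_pos (by omega), mul_one]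
  · rw [if_neg hm, if_neg (by omega), mul_zero]

/-- At the sampling instants the system acts as the discrete-time filter `h * gBL`. -/
theorem systemOutput_sincInput (hh : 0 < h) (hg : StableImpulseResponse g) (N : ℕ) (e : ℕ → ℝ)
    (k : ℕ) : systemOutput g (sincInput h N e) (((k : ℝ) + 1) * h) =
      filterOutput (fun j => h * gBL h g j) N e k := by
  have h1 : ∀ τ, g τ * sincInput h N e (((k : ℝ) + 1) * h - τ) =
      ∑ m ∈ Finset.range N, e m * (g τ * nsinc ((((k - m : ℤ) : ℝ) * h - τ) / h)) := by
    intro τ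
    rw [sincInput, Finset.mul_sum]
    refine Finset.sum_congr rfl fun m _ => ?_
    rw [show ((k : ℝ) + 1) * h - τ - ((m : ℝ) + 1) * h = ((k - m : ℤ) : ℝ) * h - τ by
      push_cast; ring]
    ring
  simp_rw [systemOutput, h1]
  rw [integral_finsetSum _ fun m _ => (integrableOn_mul_nsinc hg h _).const_mul _]
  refine Finset.sum_congr rfl fun m _ => ?_
  rw [integral_const_mul, ← mul_gBL hh]

end System

/-! ### Limits of normal equations -/

section LeastSquares

variable {ι : Type*} [Fintype ι] [DecidableEq ι]

/-- Determinant and adjugate are polynomial in the entries, hence inversion is continuous where the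
determinant is nonzero. -/
theorem tendsto_inv_mulVec {A : ℕ → Matrix ι ι ℝ} {r : ℕ → ι → ℝ} {a : ℝ} {x : ι → ℝ}
    (ha : a ≠ 0) (hA : ∀ i j, Tendsto (fun N => A N i j) atTop (𝓝 ((a • (1 : Matrix ι ι ℝ)) i j)))
    (hr : ∀ i, Tendsto (fun N => r N i) atTop (𝓝 (a * x i))) :
    (∀ᶠ N in atTop, (A N).det ≠ 0) ∧ Tendsto (fun N => (A N)⁻¹ *ᵥ r N) atTop (𝓝 x) := by
  have hA' : Tendsto A atTop (𝓝 (a • 1)) :=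
    tendsto_pi_nhds.2 fun i => tendsto_pi_nhds.2 fun j => hA i j
  have hr' : Tendsto r atTop (𝓝 (a • x)) := tendsto_pi_nhds.2 hr
  have hdet : Tendsto (fun N => (A N).det) atTop (𝓝 (a • (1 : Matrix ι ι ℝ)).det) :=
    (continuous_id.matrix_det.tendsto _).comp hA'
  have hdet0 : (a • (1 : Matrix ι ι ℝ)).det ≠ 0 := by
    rw [Matrix.det_smul, Matrix.det_one, mul_one]
    exact pow_ne_zero _ ha
  have hadj : Tendsto (fun N => (A N).adjugate) atTop (𝓝 (a • (1 : Matrix ι ι ℝ)).adjugate) :=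
    (continuous_id.matrix_adjugate.tendsto _).comp hA'
  have hinv : Tendsto (fun N => (A N)⁻¹) atTop (𝓝 (a • (1 : Matrix ι ι ℝ))⁻¹) := by
    simp_rw [Matrix.inv_def, Ring.inverse_eq_inv]
    exact (hdet.inv₀ hdet0).smul hadj
  refine ⟨hdet.eventually_ne hdet0, ?_⟩
  have hx : (a • (1 : Matrix ι ι ℝ))⁻¹ *ᵥ (a • x) = x := by
    have := Matrix.invertibleOfIsUnitDet _ (isUnit_iff_ne_zero.2 hdet0)
    refine Matrix.inv_mulVec_eq_vec ?_
    rw [Matrix.smul_mulVec, Matrix.one_mulVec]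
  have hmul : Continuous fun p : Matrix ι ι ℝ × (ι → ℝ) => p.1 *ᵥ p.2 :=
    continuous_fst.matrix_mulVec continuous_snd
  have := (hmul.tendsto ((a • (1 : Matrix ι ι ℝ))⁻¹, a • x)).comp (hinv.prodMk_nhds hr')
  rwa [hx] at this

/-- Consistency of least squares from convergence of the normalized normal equations. -/
theorem leastSquares_consistent {Φ : (N : ℕ) → Matrix (Fin N) ι ℝ} {y : (N : ℕ) → Fin N → ℝ}
    {a : ℝ} {x : ι → ℝ} (ha : a ≠ 0)
    (hΦ : ∀ i j, Tendsto (fun N : ℕ => ((Φ N)ᵀ * Φ N) i j / N) atTop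
      (𝓝 ((a • (1 : Matrix ι ι ℝ)) i j)))
    (hy : ∀ i, Tendsto (fun N : ℕ => ((Φ N)ᵀ *ᵥ y N) i / N) atTop (𝓝 (a * x i))) :
    (∀ᶠ N in atTop, IsUnit ((Φ N)ᵀ * Φ N).det) ∧
      Tendsto (fun N => leastSquares (Φ N) (y N)) atTop (𝓝 x) := by
  obtain ⟨h1, h2⟩ := tendsto_inv_mulVec (A := fun N => (N : ℝ)⁻¹ • ((Φ N)ᵀ * Φ N))
    (r := fun N => (N : ℝ)⁻¹ • ((Φ N)ᵀ *ᵥ y N)) (x := x) ha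
    (fun i j => (hΦ i j).congr fun N => by simp [div_eq_inv_mul])
    (fun i => (hy i).congr fun N => by simp [div_eq_inv_mul])
  have h3 : ∀ᶠ N in atTop, IsUnit ((Φ N)ᵀ * Φ N).det := by
    filter_upwards [h1] with N hN
    rw [Matrix.det_smul] at hN
    exact isUnit_iff_ne_zero.2 (right_ne_zero_of_mul hN)
  refine ⟨h3, h2.congr' ?_⟩
  filter_upwards [h3, eventually_ge_atTop 1] with N hN hN1
  have hN0 : (N : ℝ)⁻¹ ≠ 0 := inv_ne_zero (by positivity)
  have := invertibleOfNonzero hN0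
  rw [Matrix.inv_smul _ _ hN, invOf_eq_inv, Matrix.smul_mulVec, Matrix.mulVec_smul, smul_smul,
    inv_mul_cancel₀ hN0, one_smul, leastSquares]

end LeastSquares

/-! ### Consistency of the estimate -/

theorem regressor_sincInput {h : ℝ} (hh : 0 < h) (Mnc Mc : ℤ) (N : ℕ) (e : ℕ → ℝ) (k : Fin N)
    (n : Finset.Icc (-Mnc) Mc) :
    regressor h Mnc Mc (sincInput h N e) N k n = h * truncated N e ((k : ℕ) - n) := by
  rw [← sincInput_int_mul hh, regressor, Matrix.of_apply]
  push_cast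
  congr 3
  ring

end BandLimited

end
theorem theorem1 {Ω : Type*} [MeasurableSpace Ω] (P : Measure Ω) [IsProbabilityMeasure P]
    (h : ℝ) (hh : 0 < h)
    (g : ℝ → ℝ) (hg : BandLimited.StableImpulseResponse g)
    (e v : ℕ → Ω → ℝ) (lam sigma : ℝ) (hlam : 0 < lam)
    (he : BandLimited.IsWhiteNoise e lam P)
    (hv : BandLimited.IsZeroMeanProcess v sigma P)
    (hev : IndepFun (fun ω n => e n ω) (fun ω k => v k ω) P)
    (Mnc Mc : ℤ) (hM : 0 ≤ Mnc + Mc) :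
    ∀ᵐ ω ∂P,
      (∀ᶠ N : ℕ in atTop,
        IsUnit ((BandLimited.regressor h Mnc Mc
              (BandLimited.sincInput h N (fun n => e n ω)) N)ᵀ *
            BandLimited.regressor h Mnc Mc
              (BandLimited.sincInput h N (fun n => e n ω)) N).det) ∧
      Tendsto
        (fun N : ℕ =>
          BandLimited.leastSquares
            (BandLimited.regressor h Mnc Mc
              (BandLimited.sincInput h N (fun n => e n ω)) N)
            (BandLimited.measuredOutput h g
              (BandLimited.sincInput h N (fun n => e n ω)) (fun k => v k ω) N))
        atTop (𝓝 (BandLimited.trueCoeff h Mnc Mc g)) := by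
  obtain ⟨C, hC⟩ := BandLimited.exists_sum_gBL_sq_le hh hg
  have hdelta : ∀ (m : ℤ) (s : Finset ℤ), ∑ j ∈ s, (if j = m then (1 : ℝ) else 0) ^ 2 ≤ 1 := by
    intro m s
    simp only [ite_pow, one_pow, ne_eq, OfNat.ofNat_ne_zero, not_false_eq_true, zero_pow,
      Finset.sum_ite_eq']
    split_ifs <;> norm_num
  filter_upwards [ae_all_iff.2 fun n : ℤ => ae_all_iff.2 fun m : ℤ =>
      he.ae_tendsto_crossCorrelation (hdelta m) n,
    ae_all_iff.2 fun n : ℤ => he.ae_tendsto_crossCorrelation hC n,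
    ae_all_iff.2 fun n : ℤ => he.ae_tendsto_noiseCorrelation hv hev n] with ω h1 h2 h3
  -- In `ΦᵀΦ` each regressor entry supplies a factor `h`; in `Φᵀy` the second `h` comes from the
  -- filter `h * gBL`.
  refine BandLimited.leastSquares_consistent (a := h ^ 2 * lam ^ 2) (by positivity)
    (fun i j => ?_) (fun i => ?_)
  · have h4 := (h1 i j).const_mul (h ^ 2)
    have h5 : (((h ^ 2 * lam ^ 2) • (1 : Matrix (Finset.Icc (-Mnc) Mc) _ ℝ)) i j) =
        h ^ 2 * (lam ^ 2 * if (i : ℤ) = j then 1 else 0) := by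
      rw [Matrix.smul_apply, Matrix.one_apply, smul_eq_mul, mul_assoc]
      simp only [Subtype.ext_iff]
    rw [h5]
    refine h4.congr fun N => ?_
    rw [← mul_div_assoc, Matrix.mul_apply, Finset.mul_sum, ← Fin.sum_univ_eq_sum_range
      (fun k => h ^ 2 * (BandLimited.truncated N (fun i => e i ω) (k - i) * _))]
    congr 1
    refine Finset.sum_congr rfl fun k _ => ?_
    rw [Matrix.transpose_apply, BandLimited.regressor_sincInput hh,
      BandLimited.regressor_sincInput hh, ← BandLimited.truncated_sub_eq_filterOutput]
    ring
  · have h4 := ((h2 i).add (h3 i)).const_mul h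
    have h5 : h ^ 2 * lam ^ 2 * BandLimited.trueCoeff h Mnc Mc g i =
        h * (lam ^ 2 * (h * BandLimited.gBL h g i) + 0) := by
      rw [BandLimited.trueCoeff]
      ring
    rw [h5]
    refine h4.congr fun N => ?_
    rw [← add_div, ← mul_div_assoc, Matrix.mulVec, dotProduct, ← Finset.sum_add_distrib,
      Finset.mul_sum, ← Fin.sum_univ_eq_sum_range
      (fun k => h * (BandLimited.truncated N (fun i => e i ω) (k - i) * _ + _))]
    congr 1
    refine Finset.sum_congr rfl fun k _ => ?_
    rw [Matrix.transpose_apply, BandLimited.regressor_sincInput hh, BandLimited.measuredOutput,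
      BandLimited.systemOutput_sincInput hh hg]
    ring
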